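/- Conventions. $\mathbf R^n$ carries its standard diffeology, $I=[0,1]$, and $I^n$, $\partial I^n$ and $J^{n-1}=\partial I^{n-1}\times I\cup I^{n-1}\times\{1\}\subset I^n$ ($n\ge 1$) carry the subspace diffeologies. A pair $(X,A)$ of diffeological spaces is a diffeological space $X$ with a subspace $A$; a smooth map of pairs $f:(X,A)\to(Z,C)$ is a smooth map $f:X\to Z$ with $f(A)\subset C$. A map $\phi:\partial I^n\to Y$ is *tame* if there is $0<\epsilon\le 1/2$ such that $\phi(t_1,\dots,t_j,\dots,t_n)=\phi(t_1,\dots,\alpha,\dots,t_n)$ ($\alpha$ in the $j$-th place) whenever $t\in\partial I^n$, $\alpha\in\{0,1\}$ and $|t_j-\alpha|\le\epsilon$. A homotopy $F:X\times I\to Y$ (a smooth map) is *tame* if there is $0<\epsilon\le 1/2$ such that $F(x,t)=F(x,\alpha)$ for all $x\in X$, $t\in I$ and $\alpha\in\{0,1\}$ with $|t-\alpha|\le\epsilon$. A pair $(X,A)$ is a *relative gathered CW complex* if there are skeleta $A=X^{-1}\subset X^0\subset X^1\subset\cdots$ with $X=\operatorname{colim}_n X^n$ as diffeological spaces such that, for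 every $n\ge 0$, $X^n$ is a pushout, in diffeological spaces, of the inclusion $\coprod_{\lambda\in\Lambda_n}\partial I^n\hookrightarrow\coprod_{\lambda\in\Lambda_n}I^n$ along a map $\bigcup_\lambda\phi_\lambda:\coprod_{\lambda\in\Lambda_n}\partial I^n\to X^{n-1}$ whose components, the attaching maps $\phi_\lambda$, are smooth and tame. It is *$N$-dimensional* if $X=X^N$. For $c\in C$ and $n\ge1$, $\pi_n(Z,C,c)$ is the pointed set of homotopy classes of smooth maps of triples $(I^n,\partial I^n,J^{n-1})\to(Z,C,\{c\})$, where homotopies are smooth and run through maps of triples, and $\pi_0$ denotes the set of smooth path components. The pair $(Z,C)$ is *$N$-connected* if $\pi_0C\to\pi_0Z$ is surjective and $\pi_n(Z,C,c)=0$ for all $1\le n\le N$ and all $c\in C$. **Proposition.** Let $N\ge 0$, let $(X,A)$ be an $N$-dimensional relative gathered CW complex, let $(Z,C)$ be an $N$-connected pair of diffeological spaces, and let $f:(X,A)\to(Z,C)$ be a smooth map of pairs. Then there exist a smooth map of pairs $g:(X,A)\to(Z,C)$ with $g(X)\subset C$ and a tame homotopy of pairs $F:X\times I\to Z$ from $f$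 to $g$ relative to $A$; that is, $F$ is a tame smooth homotopy with $F(x,0)=f(x)$ and $F(x,1)=g(x)$ for all $x\in X$, and $F(a,t)=f(a)=g(a)\in C$ for all $a\in A$ and $t\in I$. -/

import Mathlib

universe u v w

namespace SmoothCW

open Diffeology DiffeologicalSpace
open scoped ContDiff

/-! ### Subspaces, products, coproducts and final diffeologies -/

/-- The subspace diffeology: a map into a subspace is a plot iff it is a plot of the ambient
space. -/
instance instSubtype {X : Type*} [DiffeologicalSpace X] (P : X → Prop) :
    DiffeologicalSpace (Subtype P) where
  plots n := {p : EuclideanSpace ℝ (Fin n) → Subtype P | IsPlot fun s => (p s : X)}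
  constant_plots _ := isPlot_const
  plot_reparam hp hf := isPlot_reparam hp hf
  locality hp := locality fun x => by
    obtain ⟨U, hU, hxU, h⟩ := hp x
    exact ⟨U, hU, hxU, fun hm hf => h hm hf⟩

/-- The product diffeology: a map into a product is a plot iff both components are plots. -/
instance instProd {X Y : Type*} [DiffeologicalSpace X] [DiffeologicalSpace Y] :
    DiffeologicalSpace (X × Y) where
  plots n := {p : EuclideanSpace ℝ (Fin n) → X × Y |
    IsPlot (fun s => (p s).1) ∧ IsPlot (fun s => (p s).2)}
  constant_plots _ := ⟨isPlot_const, isPlot_const⟩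
  plot_reparam hp hf := ⟨isPlot_reparam hp.1 hf, isPlot_reparam hp.2 hf⟩
  locality hp :=
    ⟨locality fun x => by
      obtain ⟨U, hU, hxU, h⟩ := hp x
      exact ⟨U, hU, hxU, fun hm hf => (h hm hf).1⟩,
    locality fun x => by
      obtain ⟨U, hU, hxU, h⟩ := hp x
      exact ⟨U, hU, hxU, fun hm hf => (h hm hf).2⟩⟩

/-- The finest diffeology on `Z` for which `f : X → Z` is smooth. In the lattice of diffeologies
finer means smaller, so the final diffeology defined by a family `f i : X i → Z` (the finest one
for which all `f i` are smooth) is the supremum `⨆ i, coinduced (f i)`. -/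
@[reducible]
def coinduced {X Z : Type*} [DiffeologicalSpace X] (f : X → Z) : DiffeologicalSpace Z :=
  generateFrom {q | ∃ p : EuclideanSpace ℝ (Fin q.1) → X, IsPlot p ∧ q.2 = f ∘ p}

theorem coinduced_le_iff {X Z : Type*} [DiffeologicalSpace X] (f : X → Z)
    (d : DiffeologicalSpace Z) :
    coinduced f ≤ d ↔ @DSmooth X Z _ d f := by
  rw [generateFrom_le_iff]
  constructor
  · intro h n p hp
    exact h n (f ∘ p) ⟨p, hp, rfl⟩
  · rintro h n p ⟨q, hq, hpq⟩
    have hpq' : p = f ∘ q := hpq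
    rw [hpq']
    exact h n q hq

/-- The coproduct diffeology: the final diffeology defined by the canonical injections. -/
instance instSigma {ι : Type*} {X : ι → Type*} [∀ i, DiffeologicalSpace (X i)] :
    DiffeologicalSpace (Σ i, X i) :=
  ⨆ i, coinduced (fun x : X i => (⟨i, x⟩ : Σ i, X i))

/-- The square
```
      S  --i₁-->  X₁
      |           |
      i₂          f₁
      v           v
      X₂ --f₂-->  P
```
of diffeological spaces and smooth maps is a pushout: `P` is the quotient of the disjoint union
`X₁ ⊕ X₂` by the smallest equivalence relation with `i₁ s ∼ i₂ s` for all `s`, carrying the final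
diffeology defined by `f₁` and `f₂`. -/
structure IsPushout {S X₁ X₂ P : Type*} [DiffeologicalSpace S] [DiffeologicalSpace X₁]
    [DiffeologicalSpace X₂] [dP : DiffeologicalSpace P]
    (i₁ : S → X₁) (i₂ : S → X₂) (f₁ : X₁ → P) (f₂ : X₂ → P) : Prop where
  smooth_left : DSmooth i₁
  smooth_right : DSmooth i₂
  surjective : Function.Surjective (Sum.elim f₁ f₂)
  eq_iff : ∀ a b : X₁ ⊕ X₂, Sum.elim f₁ f₂ a = Sum.elim f₁ f₂ b ↔
    Relation.EqvGen (fun a b => ∃ s, a = Sum.inl (i₁ s) ∧ b = Sum.inr (i₂ s)) a b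
  final : dP = coinduced f₁ ⊔ coinduced f₂

/-! ### Cubes and tameness -/

/-- The cube `I^n`, a subspace of `ℝ^n`. -/
def cube (n : ℕ) : Set (EuclideanSpace ℝ (Fin n)) := {t | ∀ i, 0 ≤ t i ∧ t i ≤ 1}

/-- The boundary `∂I^n` of the cube. -/
def cubeBoundary (n : ℕ) : Set (cube n) := {t | ∃ i, t.1 i = 0 ∨ t.1 i = 1}

/-- For `n ≥ 1`, the subset `J^{n-1} = ∂I^{n-1} × I ∪ I^{n-1} × {1}` of `I^n`: some coordinate other
than the last one is `0` or `1`, or the last coordinate is `1`. -/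
def cubeHorn (n : ℕ) : Set (cube n) :=
  {t | (∃ i : Fin n, i.1 + 1 < n ∧ (t.1 i = 0 ∨ t.1 i = 1)) ∨
    (∃ i : Fin n, i.1 + 1 = n ∧ t.1 i = 1)}

/-- A map `f : K → X` on a cubical subcomplex `K` of `I^n` is `ε`-tame if
`f (t₁, …, t_j, …, t_n) = f (t₁, …, α, …, t_n)` whenever `α ∈ {0, 1}` and `|t_j - α| ≤ ε`. -/
def IsTameMapWith {n : ℕ} {K : Set (cube n)} {X : Type*} (ε : ℝ) (f : K → X) : Prop :=
  ∀ (t t' : K) (j : Fin n) (α : ℝ), (α = 0 ∨ α = 1) → |t.1.1 j - α| ≤ ε →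
    t'.1.1 j = α → (∀ i, i ≠ j → t'.1.1 i = t.1.1 i) → f t = f t'

/-- A map on a cubical subcomplex is tame if it is `ε`-tame for some `0 < ε ≤ 1/2`. -/
def IsTameMap {n : ℕ} {K : Set (cube n)} {X : Type*} (f : K → X) : Prop :=
  ∃ ε : ℝ, 0 < ε ∧ ε ≤ 1 / 2 ∧ IsTameMapWith ε f

/-- A homotopy `F : X × I → Y` is tame if for some `0 < ε ≤ 1/2` one has `F (x, t) = F (x, α)` for
all `x`, `t` and `α ∈ {0, 1}` with `|t - α| ≤ ε`. -/
def IsTameHomotopy {X Y : Type*} (F : X × unitInterval → Y) : Prop :=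
  ∃ ε : ℝ, 0 < ε ∧ ε ≤ 1 / 2 ∧ ∀ (x : X) (t α : unitInterval), (α = 0 ∨ α = 1) →
    |(t : ℝ) - (α : ℝ)| ≤ ε → F (x, t) = F (x, α)

/-! ### Homotopies, path components and relative homotopy groups -/

/-- `F` is a smooth homotopy from `f` to `g`. -/
structure IsHomotopy {X Y : Type*} [DiffeologicalSpace X] [DiffeologicalSpace Y]
    (F : X × unitInterval → Y) (f g : X → Y) : Prop where
  smooth : DSmooth F
  map_zero : ∀ x, F (x, 0) = f x
  map_one : ∀ x, F (x, 1) = g x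

/-- The set `π₀ X` of smooth path components. -/
def Pi0 (X : Type*) [DiffeologicalSpace X] : Type _ :=
  Quot fun x y : X => ∃ γ : unitInterval → X, DSmooth γ ∧ γ 0 = x ∧ γ 1 = y

/-- The map `π₀ X → π₀ Y` induced by a smooth map. -/
def Pi0.map {X Y : Type*} [DiffeologicalSpace X] [DiffeologicalSpace Y] (f : X → Y)
    (hf : DSmooth f) : Pi0 X → Pi0 Y :=
  Quot.map f fun _ _ ⟨γ, hγ, h0, h1⟩ =>
    ⟨f ∘ γ, hf.comp hγ, congrArg f h0, congrArg f h1⟩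

/-- Smooth maps of triples `(X, A₁, A₂) → (Y, B₁, B₂)`. -/
def TripleMap {X Y : Type*} [DiffeologicalSpace X] [DiffeologicalSpace Y]
    (A₁ A₂ : Set X) (B₁ B₂ : Set Y) : Type _ :=
  {f : X → Y // DSmooth f ∧ Set.MapsTo f A₁ B₁ ∧ Set.MapsTo f A₂ B₂}

/-- The set `[X, A₁, A₂; Y, B₁, B₂]` of homotopy classes of smooth maps of triples, where
homotopies run through maps of triples. -/
def TripleClasses {X Y : Type*} [DiffeologicalSpace X] [DiffeologicalSpace Y]
    (A₁ A₂ : Set X) (B₁ B₂ : Set Y) : Type _ :=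
  Quot fun f g : TripleMap A₁ A₂ B₁ B₂ => ∃ F : X × unitInterval → Y, IsHomotopy F f.1 g.1 ∧
    (∀ a ∈ A₁, ∀ t, F (a, t) ∈ B₁) ∧ (∀ a ∈ A₂, ∀ t, F (a, t) ∈ B₂)

/-- For `n ≥ 1`, the relative homotopy set
`π_n(Z, C, c) = [I^n, ∂I^n, J^{n-1}; Z, C, {c}]`. -/
abbrev RelPi (n : ℕ) {Z : Type*} [DiffeologicalSpace Z] (C : Set Z) (c : C) : Type _ :=
  TripleClasses (cubeBoundary n) (cubeHorn n) C {(c : Z)}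

/-- The class of the constant map in `π_n(Z, C, c)`. -/
def RelPi.zero (n : ℕ) {Z : Type*} [DiffeologicalSpace Z] (C : Set Z) (c : C) : RelPi n C c :=
  Quot.mk _ ⟨fun _ => c, dSmooth_const, fun _ _ => c.2, fun _ _ => rfl⟩

theorem dSmooth_subtype_val {Z : Type*} [DiffeologicalSpace Z] (C : Set Z) :
    DSmooth (Subtype.val : C → Z) := fun _ _ hp => hp

/-- The pair `(Z, C)` is `N`-connected: `π₀ C → π₀ Z` is surjective and `π_n(Z, C, c) = 0` for
`1 ≤ n ≤ N` and all `c ∈ C`. -/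
def IsConnectedPair (N : ℕ) {Z : Type*} [DiffeologicalSpace Z] (C : Set Z) : Prop :=
  Function.Surjective (Pi0.map (Subtype.val : C → Z) (dSmooth_subtype_val C)) ∧
    ∀ n, 1 ≤ n → n ≤ N → ∀ (c : C) (a : RelPi n C c), a = RelPi.zero n C c

/-! ### Smooth relative CW complexes -/

/-- The structure of a smooth relative CW complex on the pair `(X, A)`. Indices of the skeleta are
shifted by one: `skel n` is the `(n-1)`-skeleton `X^{n-1}`, so that `skel 0 = X^{-1} = A`. Skeleta
are regarded as subspaces of `X`; this is no restriction, as in a pushout along the inclusion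
`∐ ∂I^n → ∐ I^n` the map `X^{n-1} → X^n` is an embedding of a subspace, and likewise for
`X^n → colim X^n`. -/
structure RelCWComplex (X : Type u) [dX : DiffeologicalSpace X] (A : Set X) where
  /-- `skel n` is the skeleton `X^{n-1}`. -/
  skel : ℕ → Set X
  skel_zero : skel 0 = A
  skel_subset_succ : ∀ n, skel n ⊆ skel (n + 1)
  /-- `X` is the union of its skeleta ... -/
  iUnion_skel : ⋃ n, skel n = Set.univ
  /-- ... and carries the colimit diffeology. -/
  final_skel : dX = ⨆ n, coinduced (Subtype.val : skel n → X)
  /-- The index set `Λ_n` of the `n`-cells. -/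
  Cell : ℕ → Type v
  /-- The attaching maps `∂I^n → X^{n-1}`. -/
  attach : ∀ n, Cell n → cubeBoundary n → skel n
  /-- The characteristic maps `I^n → X^n`. -/
  char : ∀ n, Cell n → cube n → skel (n + 1)
  /-- `X^n` is the pushout of `X^{n-1} ← ∐ ∂I^n → ∐ I^n`. -/
  isPushout : ∀ n, IsPushout
    (fun s : (Σ _ : Cell n, cubeBoundary n) => attach n s.1 s.2)
    (fun s : (Σ _ : Cell n, cubeBoundary n) => (⟨s.1, s.2.1⟩ : Σ _ : Cell n, cube n))
    (Set.inclusion (skel_subset_succ n))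
    (fun s : (Σ _ : Cell n, cube n) => char n s.1 s.2)

namespace RelCWComplex

variable {X : Type u} [DiffeologicalSpace X] {A : Set X}

/-- The complex has dimension `N`: `X = X^N`. -/
def HasDim (K : RelCWComplex.{u, v} X A) (N : ℕ) : Prop := K.skel (N + 1) = Set.univ

/-- The complex is gathered: all attaching maps are tame. -/
def IsGathered (K : RelCWComplex.{u, v} X A) : Prop :=
  ∀ n (c : K.Cell n), IsTameMap (K.attach n c)

end RelCWComplex

end SmoothCW

namespace SmoothCW

open Diffeology DiffeologicalSpace
open scoped ContDiff

/-! ### Smooth maps into subspaces, products and Euclidean spaces -/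

section Toolkit

variable {X Y Z T : Type*} [DiffeologicalSpace X] [DiffeologicalSpace Y] [DiffeologicalSpace Z]
  [DiffeologicalSpace T]

/-! The deformation of `f` into `C` is built by induction over the skeleta. Given one on X^{n-1},
each n-cell needs two moves: extend over I^n the homotopy which the attaching map pulls back to
∂I^n, then compress the end of the extension, whose boundary already lies in `C`, into `C` relative
to ∂I^n, using π_n(Z, C) = 0 (surjectivity on π₀ if n = 0). As X = X^N, finitely many steps suffice.

The difficulty is smoothness: the usual retraction of I^n × I onto I^n × {0} ∪ ∂I^n × I is not
smooth. Tameness of the attaching maps replaces it. A smooth coordinatewise clamp T throws a collar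
of ∂I^n into ∂I^n, and a map which is tame on ∂I^n is constant on the segment from a boundary point
to its clamp (`eq_segment_of_tame`). Boundary data therefore extend over the collar through T, and a
bump function fades the boundary move out towards the interior (`exists_homotopy_extension`) or the
interior move out towards the boundary (`exists_compression`). Elements of π_n must collapse the
horn, which `push` achieves by an explicit homotopy.

Time changes that are flat at both ends make concatenations smooth. The cells assemble to a smooth
map on X^n × I because products preserve final diffeologies (`IsPushout.dSmooth_prod`). -/

theorem dSmooth_val {P : X → Prop} : DSmooth (Subtype.val : Subtype P → X) := fun _ _ hp => hp

theorem _root_.Diffeology.DSmooth.subtype_mk {P : Y → Prop} {f : X → Y} (hf : DSmooth f)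
    (h : ∀ x, P (f x)) : DSmooth fun x => (⟨f x, h x⟩ : Subtype P) := fun n p hp => hf n p hp

theorem dSmooth_fst : DSmooth (Prod.fst : X × Y → X) := fun _ _ hp => hp.1

theorem dSmooth_snd : DSmooth (Prod.snd : X × Y → Y) := fun _ _ hp => hp.2

theorem _root_.Diffeology.DSmooth.prodMk {f : X → Y} {g : X → Z} (hf : DSmooth f)
    (hg : DSmooth g) : DSmooth fun x => (f x, g x) := fun n p hp => ⟨hf n p hp, hg n p hp⟩

theorem _root_.Diffeology.DSmooth.contDiff_comp {φ : ℝ → ℝ} {f : X → ℝ} (hφ : ContDiff ℝ ∞ φ)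
    (hf : DSmooth f) : DSmooth fun x => φ (f x) := hφ.dSmooth.comp hf

theorem _root_.Diffeology.DSmooth.add {f g : X → ℝ} (hf : DSmooth f) (hg : DSmooth g) :
    DSmooth fun x => f x + g x :=
  fun n p hp => ((hf n p hp).contDiff.add (hg n p hp).contDiff).isPlot

theorem _root_.Diffeology.DSmooth.sub {f g : X → ℝ} (hf : DSmooth f) (hg : DSmooth g) :
    DSmooth fun x => f x - g x :=
  fun n p hp => ((hf n p hp).contDiff.sub (hg n p hp).contDiff).isPlot

theorem _root_.Diffeology.DSmooth.mul {f g : X → ℝ} (hf : DSmooth f) (hg : DSmooth g) :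
    DSmooth fun x => f x * g x :=
  fun n p hp => ((hf n p hp).contDiff.mul (hg n p hp).contDiff).isPlot

theorem _root_.Diffeology.DSmooth.finset_prod {ι : Type*} {s : Finset ι} {f : ι → X → ℝ}
    (hf : ∀ i ∈ s, DSmooth (f i)) : DSmooth fun x => ∏ i ∈ s, f i x := by
  classical
  induction s using Finset.induction_on with
  | empty => simpa using dSmooth_const
  | insert a s ha ih =>
    simp only [Finset.prod_insert ha]
    exact (hf a (by simp)).mul (ih fun i hi => hf i (by simp [hi]))

theorem dSmooth_euclidean {ι : Type*} [Fintype ι] {f : X → EuclideanSpace ℝ ι}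
    (hf : ∀ i, DSmooth fun x => f x i) : DSmooth f :=
  fun n p hp => (contDiff_euclidean.2 fun i => (hf i n p hp).contDiff).isPlot

theorem dSmooth_coord {ι : Type*} [Fintype ι] (i : ι) :
    DSmooth fun x : EuclideanSpace ℝ ι => x i :=
  ContDiff.dSmooth (contDiff_euclidean.1 contDiff_id i)

/-- A map is smooth if its restrictions to the two open sets `{φ < b}` and `{a < φ}` are, where
`a < b` and `φ` is a smooth function. -/
theorem dSmooth_of_cover {F : X → Z} {φ : X → ℝ} (hφ : DSmooth φ) {a b : ℝ} (hab : a < b)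
    {F₁ : {x // φ x < b} → Z} {F₂ : {x // a < φ x} → Z} (h₁ : DSmooth F₁) (h₂ : DSmooth F₂)
    (e₁ : ∀ x, F x.1 = F₁ x) (e₂ : ∀ x, F x.1 = F₂ x) : DSmooth F := by
  intro n p hp
  have hc : Continuous fun x => φ (p x) := (hφ n p hp).contDiff.continuous
  refine locality fun x => ?_
  rcases lt_or_ge (φ (p x)) b with hx | hx
  · refine ⟨_, isOpen_lt hc continuous_const, hx, fun {m f} hf hfs => ?_⟩
    have : IsPlot fun s => F₁ ⟨p (f s), hf s⟩ :=
      h₁ m (fun s => ⟨p (f s), hf s⟩) (isPlot_reparam hp hfs)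
    exact (funext fun s => e₁ ⟨p (f s), hf s⟩ : (F ∘ p) ∘ f = _) ▸ this
  · refine ⟨_, isOpen_lt continuous_const hc, hab.trans_le hx, fun {m f} hf hfs => ?_⟩
    have : IsPlot fun s => F₂ ⟨p (f s), hf s⟩ :=
      h₂ m (fun s => ⟨p (f s), hf s⟩) (isPlot_reparam hp hfs)
    exact (funext fun s => e₂ ⟨p (f s), hf s⟩ : (F ∘ p) ∘ f = _) ▸ this

/-! ### Maps out of a product with a final diffeology -/

/-- The coarsest diffeology on `X` for which `F : X × T → Z` is smooth, provided that all
`F (x, ·)` are. -/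
@[reducible]
def curryDiffeology {X : Type*} (F : X × T → Z) (hF : ∀ x, DSmooth fun t => F (x, t)) :
    DiffeologicalSpace X where
  plots n := {p | ∀ (m : ℕ) (f : EuclideanSpace ℝ (Fin m) → EuclideanSpace ℝ (Fin n))
    (q : EuclideanSpace ℝ (Fin m) → T), ContDiff ℝ ∞ f → IsPlot q →
      IsPlot fun s => F (p (f s), q s)}
  constant_plots x := fun m _ q _ hq => hF x m q hq
  plot_reparam hp hg := fun m f q hf hq => hp m _ q (hg.comp hf) hq
  locality {n p} hp := fun m f q hf hq => locality fun s => by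
    obtain ⟨U, hU, hsU, h⟩ := hp (f s)
    refine ⟨f ⁻¹' U, hU.preimage hf.continuous, hsU, fun {l g} hg hgs => ?_⟩
    exact h (f := f ∘ g) hg (hf.comp hgs) l id (q ∘ g) contDiff_id (isPlot_reparam hq hgs)

/-- With the next lemma this is cartesian closedness in disguise: a final diffeology on `X` is a
supremum, so comparing it with `curryDiffeology` reduces smoothness on `X × T` to the generating
maps. -/
theorem dSmooth_of_le_curryDiffeology {F : X × T → Z} (hF : ∀ x, DSmooth fun t => F (x, t))
    (h : ‹DiffeologicalSpace X› ≤ curryDiffeology F hF) : DSmooth F := fun n p hp =>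
  le_iff'.1 h n (fun s => (p s).1) hp.1 n id (fun s => (p s).2) contDiff_id hp.2

theorem coinduced_le_curryDiffeology {S X : Type*} [DiffeologicalSpace S] {F : X × T → Z}
    (hF : ∀ x, DSmooth fun t => F (x, t)) {i : S → X}
    (hi : DSmooth fun y : S × T => F (i y.1, y.2)) :
    coinduced i ≤ curryDiffeology F hF := by
  rw [coinduced_le_iff]
  intro n p hp m f q hf hq
  exact hi m (fun s => (p (f s), q s)) ⟨isPlot_reparam hp hf, hq⟩

theorem dSmooth_curry_right {F : X × T → Z} (hF : DSmooth F) (x : X) :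
    DSmooth fun t => F (x, t) := hF.comp (dSmooth_const.prodMk dSmooth_id)

theorem dSmooth_sigma_mk {ι : Type*} {X : ι → Type*} [∀ i, DiffeologicalSpace (X i)] (i : ι) :
    DSmooth fun x : X i => (⟨i, x⟩ : Σ i, X i) :=
  (coinduced_le_iff _ _).1
    (le_iSup (fun i => coinduced fun x : X i => (⟨i, x⟩ : Σ i, X i)) i)

theorem dSmooth_sigma_prod {ι : Type*} {X : ι → Type*} [∀ i, DiffeologicalSpace (X i)]
    {F : (Σ i, X i) × T → Z} (hF : ∀ i, DSmooth fun y : X i × T => F (⟨i, y.1⟩, y.2)) :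
    DSmooth F :=
  dSmooth_of_le_curryDiffeology (fun x => dSmooth_curry_right (hF x.1) x.2)
    (iSup_le fun i => coinduced_le_curryDiffeology _ (hF i))

theorem IsPushout.dSmooth_prod {S X₁ X₂ P : Type*} [DiffeologicalSpace S] [DiffeologicalSpace X₁]
    [DiffeologicalSpace X₂] [DiffeologicalSpace P] {i₁ : S → X₁} {i₂ : S → X₂} {f₁ : X₁ → P}
    {f₂ : X₂ → P} (h : IsPushout i₁ i₂ f₁ f₂) {F : P × T → Z}
    (h₁ : DSmooth fun y : X₁ × T => F (f₁ y.1, y.2))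
    (h₂ : DSmooth fun y : X₂ × T => F (f₂ y.1, y.2)) : DSmooth F := by
  have hF : ∀ x, DSmooth fun t => F (x, t) := fun x => by
    obtain ⟨a | a, rfl⟩ := h.surjective x
    · exact dSmooth_curry_right h₁ a
    · exact dSmooth_curry_right h₂ a
  refine dSmooth_of_le_curryDiffeology hF (h.final.trans_le ?_)
  exact sup_le (coinduced_le_curryDiffeology hF h₁) (coinduced_le_curryDiffeology hF h₂)

theorem IsPushout.exists_desc {S X₁ X₂ P W : Type*} [DiffeologicalSpace S] [DiffeologicalSpace X₁]
    [DiffeologicalSpace X₂] [DiffeologicalSpace P] {i₁ : S → X₁} {i₂ : S → X₂} {f₁ : X₁ → P}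
    {f₂ : X₂ → P} (h : IsPushout i₁ i₂ f₁ f₂) (φ₁ : X₁ → W) (φ₂ : X₂ → W)
    (hφ : ∀ s, φ₁ (i₁ s) = φ₂ (i₂ s)) : ∃ φ : P → W, (∀ x, φ (f₁ x) = φ₁ x) ∧
      ∀ x, φ (f₂ x) = φ₂ x := by
  have key : ∀ a b, Sum.elim f₁ f₂ a = Sum.elim f₁ f₂ b → Sum.elim φ₁ φ₂ a = Sum.elim φ₁ φ₂ b := by
    intro a b hab
    induction (h.eq_iff a b).1 hab with
    | rel a b hr =>
      obtain ⟨s, rfl, rfl⟩ := hr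
      exact hφ s
    | refl a => rfl
    | symm a b hr ih => exact (ih ((h.eq_iff a b).2 hr)).symm
    | trans a b c hr hr' ih ih' =>
      exact (ih ((h.eq_iff a b).2 hr)).trans (ih' ((h.eq_iff b c).2 hr'))
  choose σ hσ using h.surjective
  exact ⟨fun x => Sum.elim φ₁ φ₂ (σ x), fun x => key _ (Sum.inl x) (hσ _),
    fun x => key _ (Sum.inr x) (hσ _)⟩

end Toolkit

/-! ### Reparametrization and concatenation of homotopies -/

/-- The smooth time change `t ↦ S (a t + b)`, with `S` the smooth transition function. -/
noncomputable def timeStep (a b : ℝ) (t : unitInterval) : unitInterval :=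
  ⟨Real.smoothTransition (a * t + b), Real.smoothTransition.nonneg _,
    Real.smoothTransition.le_one _⟩

theorem dSmooth_timeStep (a b : ℝ) : DSmooth (timeStep a b) :=
  (((dSmooth_const.mul dSmooth_val).add dSmooth_const).contDiff_comp
    Real.smoothTransition.contDiff).subtype_mk _

theorem timeStep_eq_zero {a b : ℝ} {t : unitInterval} (h : a * t + b ≤ 0) : timeStep a b t = 0 :=
  Subtype.ext (Real.smoothTransition.zero_of_nonpos h)

theorem timeStep_eq_one {a b : ℝ} {t : unitInterval} (h : 1 ≤ a * t + b) : timeStep a b t = 1 :=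
  Subtype.ext (Real.smoothTransition.one_of_one_le h)

section Homotopy

variable {X Z : Type*} [DiffeologicalSpace X] [DiffeologicalSpace Z]

theorem dSmooth_reparam {F : X × unitInterval → Z} (hF : DSmooth F) (a b : ℝ) :
    DSmooth fun y : X × unitInterval => F (y.1, timeStep a b y.2) :=
  hF.comp (dSmooth_fst.prodMk ((dSmooth_timeStep a b).comp dSmooth_snd))

/-- The concatenation of two homotopies. -/
noncomputable def concat (F G : X × unitInterval → Z) (y : X × unitInterval) : Z :=
  if (y.2 : ℝ) < 1 / 2 then F (y.1, timeStep 3 0 y.2) else G (y.1, timeStep 3 (-2) y.2)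

/-- The first homotopy is over by time 1/3 and the second starts at 2/3, so the result is stationary
on the overlap of the open sets t < 2/3 and t > 1/3. -/
theorem IsHomotopy.concat {F G : X × unitInterval → Z} {f g h : X → Z} (hF : IsHomotopy F f g)
    (hG : IsHomotopy G g h) : IsHomotopy (concat F G) f h where
  smooth := by
    refine dSmooth_of_cover (φ := fun y : X × unitInterval => (y.2 : ℝ))
      (dSmooth_val.comp dSmooth_snd)
      (show (1 / 3 : ℝ) < 2 / 3 by norm_num) ((dSmooth_reparam hF.smooth 3 0).comp dSmooth_val)
      ((dSmooth_reparam hG.smooth 3 (-2)).comp dSmooth_val) ?_ ?_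
    · rintro ⟨⟨x, t⟩, ht⟩
      simp only [SmoothCW.concat, Function.comp] at ht ⊢
      split_ifs with h
      · rfl
      · rw [timeStep_eq_zero (by linarith), timeStep_eq_one (by linarith), hF.map_one, hG.map_zero]
    · rintro ⟨⟨x, t⟩, ht⟩
      simp only [SmoothCW.concat, Function.comp] at ht ⊢
      split_ifs with h
      · rw [timeStep_eq_one (by linarith), timeStep_eq_zero (by linarith), hF.map_one, hG.map_zero]
      · rfl
  map_zero x := by
    simp [SmoothCW.concat, timeStep_eq_zero, hF.map_zero]
  map_one x := by
    rw [SmoothCW.concat, if_neg (by norm_num), timeStep_eq_one (by norm_num), hG.map_one]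

theorem IsHomotopy.symm {F : X × unitInterval → Z} {f g : X → Z} (hF : IsHomotopy F f g) :
    IsHomotopy (fun y => F (y.1, unitInterval.symm y.2)) g f where
  smooth := hF.smooth.comp (dSmooth_fst.prodMk
    ((dSmooth_const.sub (dSmooth_val.comp dSmooth_snd)).subtype_mk _))
  map_zero x := by simp [hF.map_one]
  map_one x := by simp [hF.map_zero]

theorem isHomotopy_refl {f : X → Z} (hf : DSmooth f) : IsHomotopy (fun y => f y.1) f f :=
  ⟨hf.comp dSmooth_fst, fun _ => rfl, fun _ => rfl⟩

omit [DiffeologicalSpace X] [DiffeologicalSpace Z] in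
theorem concat_mem {F G : X × unitInterval → Z} {B : Set Z} {x : X} (hF : ∀ t, F (x, t) ∈ B)
    (hG : ∀ t, G (x, t) ∈ B) (t : unitInterval) : concat F G (x, t) ∈ B := by
  unfold concat
  split_ifs
  exacts [hF _, hG _]

/-- Maps of triples with the same class are homotopic by a single homotopy through maps of
triples. -/
theorem TripleClasses.exact {A₁ A₂ : Set X} {B₁ B₂ : Set Z} {f g : TripleMap A₁ A₂ B₁ B₂}
    (h : (Quot.mk _ f : TripleClasses A₁ A₂ B₁ B₂) = Quot.mk _ g) :
    ∃ F : X × unitInterval → Z, IsHomotopy F f.1 g.1 ∧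
      (∀ a ∈ A₁, ∀ t, F (a, t) ∈ B₁) ∧ (∀ a ∈ A₂, ∀ t, F (a, t) ∈ B₂) := by
  replace h := Quot.eqvGen_exact h
  induction h with
  | rel f g h => exact h
  | refl f =>
    exact ⟨_, isHomotopy_refl f.2.1, fun a ha _ => f.2.2.1 ha, fun a ha _ => f.2.2.2 ha⟩
  | symm f g h ih =>
    obtain ⟨F, hF, h₁, h₂⟩ := ih
    exact ⟨_, hF.symm, fun a ha _ => h₁ a ha _, fun a ha _ => h₂ a ha _⟩
  | trans f g k h h' ih ih' =>
    obtain ⟨F, hF, h₁, h₂⟩ := ih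
    obtain ⟨G, hG, k₁, k₂⟩ := ih'
    exact ⟨_, hF.concat hG, fun a ha => concat_mem (h₁ a ha) (k₁ a ha),
      fun a ha => concat_mem (h₂ a ha) (k₂ a ha)⟩

theorem isHomotopy_path {γ : unitInterval → Z} (hγ : DSmooth γ) :
    IsHomotopy (fun y : X × unitInterval => γ y.2) (fun _ => γ 0) (fun _ => γ 1) :=
  ⟨hγ.comp dSmooth_snd, fun _ => rfl, fun _ => rfl⟩

/-- Points in the same smooth path component are joined by a single smooth path, here regarded as
a homotopy of constant maps. -/
theorem Pi0.exact (X : Type*) [DiffeologicalSpace X] {a b : Z}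
    (h : (Quot.mk _ a : Pi0 Z) = Quot.mk _ b) :
    ∃ F : X × unitInterval → Z, IsHomotopy F (fun _ => a) (fun _ => b) := by
  replace h := Quot.eqvGen_exact h
  induction h with
  | rel a b h =>
    obtain ⟨γ, hγ, rfl, rfl⟩ := h
    exact ⟨_, isHomotopy_path hγ⟩
  | refl a => exact ⟨_, isHomotopy_refl dSmooth_const⟩
  | symm a b h ih => exact ⟨_, ih.choose_spec.symm⟩
  | trans a b c h h' ih ih' =>
    exact ⟨_, ih.choose_spec.concat ih'.choose_spec⟩

end Homotopy

/-! ### Rounding and tame maps -/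

/-- Round points at distance at most `ε` from `0` or `1` to these values. -/
noncomputable def round (ε x : ℝ) : ℝ := if x ≤ ε then 0 else if 1 - ε ≤ x then 1 else x

/-- The fibres of rounding on [0, 1] are [0, ε], [1 - ε, 1] and single points, all convex; `ε ≤ 1 /
4` keeps the two intervals disjoint. -/
theorem round_segment {ε x y : ℝ} (hε : ε ≤ 1 / 4) (h : round ε y = round ε x) (h0 : 0 ≤ x)
    (h0' : 0 ≤ y) (h1 : x ≤ 1) (h1' : y ≤ 1) (r : unitInterval) :
    round ε (x + r * (y - x)) = round ε x := by
  obtain ⟨r, hr0, hr1⟩ := r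
  have e₁ : x + r * (y - x) = (1 - r) * x + r * y := by ring
  have hr' : 0 ≤ 1 - r := sub_nonneg.2 hr1
  simp only [e₁]
  unfold round at h ⊢
  by_cases hx : x ≤ ε
  · have hy : y ≤ ε := by
      by_contra hy
      rw [if_pos hx, if_neg hy] at h
      split_ifs at h <;> linarith
    rw [if_pos hx, if_pos]
    nlinarith [mul_nonneg hr' (sub_nonneg.2 hx), mul_nonneg hr0 (sub_nonneg.2 hy)]
  by_cases hx' : 1 - ε ≤ x
  · have hy : 1 - ε ≤ y := by
      by_contra hy
      rw [if_neg hx, if_pos hx', if_neg hy] at h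
      split_ifs at h <;> linarith
    have : 1 - ε ≤ (1 - r) * x + r * y := by
      nlinarith [mul_nonneg hr' (sub_nonneg.2 hx'), mul_nonneg hr0 (sub_nonneg.2 hy)]
    rw [if_neg hx, if_pos hx', if_neg (by linarith), if_pos this]
  · have hy : y = x := by
      rw [if_neg hx, if_neg hx'] at h
      split_ifs at h <;> linarith
    have e₂ : (1 - r) * x + r * y = x := by rw [hy]; ring
    rw [e₂]

theorem IsTameMapWith.mono {n : ℕ} {K : Set (cube n)} {X : Type*} {ε δ : ℝ} {f : K → X}
    (hf : IsTameMapWith ε f) (h : δ ≤ ε) : IsTameMapWith δ f :=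
  fun t t' j α hα ht => hf t t' j α hα (ht.trans h)

theorem IsTameMapWith.comp {n : ℕ} {K : Set (cube n)} {X Y : Type*} {ε : ℝ} {f : K → X}
    (hf : IsTameMapWith ε f) (g : X → Y) : IsTameMapWith ε fun t => g (f t) :=
  fun t t' j α hα ht h h' => congrArg g (hf t t' j α hα ht h h')

theorem round_mem {ε x : ℝ} (h : 0 ≤ x ∧ x ≤ 1) : 0 ≤ round ε x ∧ round ε x ≤ 1 := by
  unfold round
  split_ifs
  · simp
  · simp
  · exact h

theorem round_zero {ε : ℝ} (hε : 0 < ε) : round ε 0 = 0 := if_pos hε.le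

theorem round_one {ε : ℝ} (hε : 0 < ε) (hε' : ε ≤ 1 / 4) : round ε 1 = 1 := by
  rw [round, if_neg (by linarith), if_pos (by linarith)]

/-- Tameness permits rounding one coordinate at a time, and rounding fixes 0 and 1, so the point
never leaves the boundary. Hence a tame map depends only on the rounded coordinates. -/
theorem IsTameMapWith.eq_of_round_eq {n : ℕ} {Y : Type*} {φ : cubeBoundary n → Y} {ε : ℝ}
    (hε : 0 < ε) (hε' : ε ≤ 1 / 4) (hφ : IsTameMapWith ε φ) {s s' : cubeBoundary n}
    (h : ∀ i, round ε (s.1.1 i) = round ε (s'.1.1 i)) : φ s = φ s' := by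
  classical
  let R : Finset (Fin n) → cubeBoundary n → cubeBoundary n := fun A s =>
    ⟨⟨WithLp.toLp 2 fun i => if i ∈ A then round ε (s.1.1 i) else s.1.1 i, fun i => by
      show 0 ≤ ite _ _ _ ∧ ite _ _ _ ≤ _
      split_ifs
      exacts [round_mem (s.1.2 i), s.1.2 i]⟩, by
      obtain ⟨i, hi⟩ := s.2
      refine ⟨i, ?_⟩
      show ite _ _ _ = _ ∨ ite _ _ _ = _
      rcases hi with hi | hi
      · left
        simp [hi, round_zero hε]
      · right
        simp [hi, round_one hε hε']⟩
  have hR : ∀ A s, φ (R A s) = φ s := by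
    intro A s
    induction A using Finset.induction_on with
    | empty => rfl
    | insert a A ha ih =>
      rw [← ih]
      have hother : ∀ i, i ≠ a → (R A s).1.1 i = (R (insert a A) s).1.1 i := fun i hi => by
        simp [R, hi]
      have h1 : (R A s).1.1 a = s.1.1 a := by simp [R, ha]
      have h2 : (R (insert a A) s).1.1 a = round ε (s.1.1 a) := by simp [R]
      have hs := s.1.2 a
      by_cases hx : s.1.1 a ≤ ε
      · refine (hφ _ _ a 0 (Or.inl rfl) ?_ ?_ fun i hi => (hother i hi).symm).symm
        · rw [h1, sub_zero, abs_of_nonneg hs.1]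
          exact hx
        · rw [h2, round, if_pos hx]
      by_cases hx' : 1 - ε ≤ s.1.1 a
      · refine (hφ _ _ a 1 (Or.inr rfl) ?_ ?_ fun i hi => (hother i hi).symm).symm
        · rw [h1, abs_sub_comm, abs_of_nonneg (sub_nonneg.2 hs.2)]
          linarith
        · rw [h2, round, if_neg hx, if_pos hx']
      · congr 1
        refine Subtype.ext (Subtype.ext (PiLp.ext fun i => ?_))
        by_cases hi : i = a
        · rw [hi, h1, h2, round, if_neg hx, if_neg hx']
        · exact (hother i hi).symm
  rw [← hR Finset.univ s, ← hR Finset.univ s']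
  congr 1
  refine Subtype.ext (Subtype.ext (PiLp.ext fun i => ?_))
  simpa [R] using h i

/-! ### A smooth clamp -/

/-- A smooth map from the line to `[0, 1]` which is `0` on `(-∞, ε/2]`, the identity on
`[ε, 1 - ε]` and `1` on `[1 - ε/2, ∞)`. -/
noncomputable def clamp (ε x : ℝ) : ℝ :=
  x * Real.smoothTransition (2 / ε * x - 1) * Real.smoothTransition (2 / ε * (1 - x) - 1) +
    (1 - Real.smoothTransition (2 / ε * (1 - x) - 1))

theorem contDiff_clamp (ε : ℝ) : ContDiff ℝ ∞ (clamp ε) := by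
  have h := Real.smoothTransition.contDiff (n := ⊤)
  unfold clamp
  exact ((contDiff_id.mul (h.comp (by fun_prop))).mul (h.comp (by fun_prop))).add
    (contDiff_const.sub (h.comp (by fun_prop)))

section Clamp

variable {ε x : ℝ} (hε : 0 < ε) (hε' : ε ≤ 1 / 4)

include hε

theorem smoothTransition_eq_zero (h : x ≤ ε / 2) :
    Real.smoothTransition (2 / ε * x - 1) = 0 := by
  apply Real.smoothTransition.zero_of_nonpos
  rw [div_mul_eq_mul_div, sub_nonpos, div_le_one hε]
  linarith

theorem smoothTransition_eq_one (h : ε ≤ x) : Real.smoothTransition (2 / ε * x - 1) = 1 := by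
  apply Real.smoothTransition.one_of_one_le
  rw [div_mul_eq_mul_div, le_sub_iff_add_le, le_div_iff₀ hε]
  linarith

theorem clamp_eq_one (h : 1 - ε / 2 ≤ x) : clamp ε x = 1 := by
  simp [clamp, smoothTransition_eq_zero hε (x := 1 - x) (by linarith)]

theorem clamp_of_le (h : x ≤ 1 - ε) :
    clamp ε x = x * Real.smoothTransition (2 / ε * x - 1) := by
  simp [clamp, smoothTransition_eq_one hε (x := 1 - x) (by linarith)]

theorem clamp_of_ge (h : ε ≤ x) :
    clamp ε x = 1 - (1 - x) * Real.smoothTransition (2 / ε * (1 - x) - 1) := by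
  rw [clamp, smoothTransition_eq_one hε h]
  ring

include hε'

theorem clamp_eq_zero (h : x ≤ ε / 2) : clamp ε x = 0 := by
  rw [clamp_of_le hε (by linarith), smoothTransition_eq_zero hε h, mul_zero]

theorem clamp_mem (x : ℝ) : 0 ≤ clamp ε x ∧ clamp ε x ≤ 1 := by
  rcases le_total x (1 / 2) with h | h
  · rcases le_total x (ε / 2) with h' | h'
    · simp [clamp_eq_zero hε hε' h']
    · rw [clamp_of_le hε (by linarith)]
      have h0 := Real.smoothTransition.nonneg (2 / ε * x - 1)
      have h1 := Real.smoothTransition.le_one (2 / ε * x - 1)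
      constructor
      · exact mul_nonneg (by linarith) h0
      · nlinarith
  · rcases le_total (1 - ε / 2) x with h' | h'
    · simp [clamp_eq_one hε h']
    · rw [clamp_of_ge hε (by linarith)]
      have h0 := Real.smoothTransition.nonneg (2 / ε * (1 - x) - 1)
      have h1 := Real.smoothTransition.le_one (2 / ε * (1 - x) - 1)
      constructor
      · nlinarith
      · linarith [mul_nonneg (show 0 ≤ 1 - x by linarith) h0]

/-- On [0, 1] the clamp only moves points within [0, ε] or [1 - ε, 1], towards the near end, which
is invisible to tame maps. -/
theorem round_clamp (h : 0 ≤ x) (h' : x ≤ 1) : round ε (clamp ε x) = round ε x := by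
  by_cases hx : x ≤ ε
  · have : clamp ε x ≤ ε := by
      rw [clamp_of_le hε (by linarith)]
      exact (mul_le_of_le_one_right h (Real.smoothTransition.le_one _)).trans hx
    rw [round, round, if_pos hx, if_pos this]
  by_cases hx' : 1 - ε ≤ x
  · have : 1 - ε ≤ clamp ε x := by
      rw [clamp_of_ge hε (by linarith)]
      linarith [mul_le_of_le_one_right (sub_nonneg.2 h')
        (Real.smoothTransition.le_one (2 / ε * (1 - x) - 1))]
    rw [round, round, if_neg hx, if_pos hx', if_neg (by linarith), if_pos this]
  · rw [clamp_of_le hε (by linarith), smoothTransition_eq_one hε (by linarith), mul_one]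

/-- The coordinatewise clamp from Euclidean space to the cube. -/
noncomputable def clampCube {n : ℕ} (x : EuclideanSpace ℝ (Fin n)) : cube n :=
  ⟨WithLp.toLp 2 fun i => clamp ε (x i), fun i => clamp_mem hε hε' (x i)⟩

theorem dSmooth_clampCube {n : ℕ} : DSmooth (clampCube hε hε' (n := n)) :=
  DSmooth.subtype_mk (dSmooth_euclidean fun i : Fin n => (dSmooth_coord i).contDiff_comp
    (contDiff_clamp ε)) _

theorem clampCube_mem_boundary {n : ℕ} {x : EuclideanSpace ℝ (Fin n)} {i : Fin n}
    (h : x i ≤ ε / 2 ∨ 1 - ε / 2 ≤ x i) : clampCube hε hε' x ∈ cubeBoundary n :=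
  ⟨i, h.imp (clamp_eq_zero hε hε') (clamp_eq_one hε)⟩

end Clamp

/-! ### A bump function on the cube -/

/-- A smooth function on the cube which vanishes on the boundary and is `1` on
`[ε/2, 1 - ε/2]^n`. -/
noncomputable def bump (ε : ℝ) {n : ℕ} (x : cube n) : ℝ :=
  ∏ i, (Real.smoothTransition (2 / ε * x.1 i) * Real.smoothTransition (2 / ε * (1 - x.1 i)))

theorem dSmooth_cube_coord {n : ℕ} (i : Fin n) : DSmooth fun x : cube n => x.1 i :=
  (dSmooth_coord i).comp dSmooth_val

theorem dSmooth_bump (ε : ℝ) {n : ℕ} : DSmooth (bump ε (n := n)) :=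
  DSmooth.finset_prod fun i _ =>
    ((dSmooth_const.mul (dSmooth_cube_coord i)).contDiff_comp Real.smoothTransition.contDiff).mul
    ((dSmooth_const.mul (dSmooth_const.sub (dSmooth_cube_coord i))).contDiff_comp
      Real.smoothTransition.contDiff)

theorem bump_nonneg (ε : ℝ) {n : ℕ} (x : cube n) : 0 ≤ bump ε x :=
  Finset.prod_nonneg fun _ _ => mul_nonneg (Real.smoothTransition.nonneg _)
    (Real.smoothTransition.nonneg _)

theorem bump_le_one (ε : ℝ) {n : ℕ} (x : cube n) : bump ε x ≤ 1 :=
  Finset.prod_le_one (fun _ _ => mul_nonneg (Real.smoothTransition.nonneg _)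
    (Real.smoothTransition.nonneg _)) fun _ _ => mul_le_one₀ (Real.smoothTransition.le_one _)
    (Real.smoothTransition.nonneg _) (Real.smoothTransition.le_one _)

theorem bump_boundary (ε : ℝ) {n : ℕ} {x : cube n} (h : x ∈ cubeBoundary n) : bump ε x = 0 := by
  obtain ⟨i, hi⟩ := h
  refine Finset.prod_eq_zero (Finset.mem_univ i) ?_
  rcases hi with hi | hi <;> simp [hi]

/-- The thresholds of bump and clamp match at ε/2. The resulting dichotomy, bump equal to 1 or clamp
in the boundary, drives both gluing constructions below. -/
theorem clampCube_mem_boundary_of_bump {ε : ℝ} (hε : 0 < ε) (hε' : ε ≤ 1 / 4) {n : ℕ} {x : cube n}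
    (h : bump ε x ≠ 1) : clampCube hε hε' x.1 ∈ cubeBoundary n := by
  by_contra hx
  refine h (Finset.prod_eq_one fun i _ => ?_)
  have hi : ¬ (x.1 i ≤ ε / 2 ∨ 1 - ε / 2 ≤ x.1 i) := fun hi =>
    hx (clampCube_mem_boundary hε hε' hi)
  push Not at hi
  have key : ∀ y, ε / 2 ≤ y → Real.smoothTransition (2 / ε * y) = 1 := fun y hy => by
    apply Real.smoothTransition.one_of_one_le
    rw [div_mul_eq_mul_div, le_div_iff₀ hε]
    linarith
  rw [key _ hi.1.le, key _ (by linarith), mul_one]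

/-! ### Straight-line homotopies in the cube -/

/-- The point at time `r` of the segment from `x` to `y`. -/
noncomputable def segment {n : ℕ} (x y : cube n) (r : unitInterval) : cube n :=
  ⟨WithLp.toLp 2 fun i => x.1 i + r * (y.1 i - x.1 i), fun i => by
    have hx := x.2 i
    have hy := y.2 i
    have hr := r.2
    have e : x.1 i + r * (y.1 i - x.1 i) = (1 - r) * x.1 i + r * y.1 i := by ring
    show 0 ≤ x.1 i + r * (y.1 i - x.1 i) ∧ x.1 i + r * (y.1 i - x.1 i) ≤ 1
    rw [e]
    constructor
    · exact add_nonneg (mul_nonneg (sub_nonneg.2 hr.2) hx.1) (mul_nonneg hr.1 hy.1)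
    · nlinarith [mul_nonneg (sub_nonneg.2 hr.2) (sub_nonneg.2 hx.2),
        mul_nonneg hr.1 (sub_nonneg.2 hy.2)]⟩

theorem segment_zero {n : ℕ} (x y : cube n) : segment x y 0 = x :=
  Subtype.ext (PiLp.ext fun i => by simp [segment])

theorem segment_one {n : ℕ} (x y : cube n) : segment x y 1 = y :=
  Subtype.ext (PiLp.ext fun i => by simp [segment])

theorem dSmooth_segment {n : ℕ} {X : Type*} [DiffeologicalSpace X] {e e' : X → cube n}
    {r : X → unitInterval} (he : DSmooth e) (he' : DSmooth e') (hr : DSmooth r) :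
    DSmooth fun x => segment (e x) (e' x) (r x) :=
  DSmooth.subtype_mk (dSmooth_euclidean fun i => ((dSmooth_cube_coord i).comp he).add
    ((dSmooth_val.comp hr).mul (((dSmooth_cube_coord i).comp he').sub
      ((dSmooth_cube_coord i).comp he)))) _

/-- If a map is tame on the boundary of the cube, it is constant on segments joining a boundary
point to a point of the same face with the same rounding. -/
theorem eq_segment_of_tame {n : ℕ} {Z : Type*} {k : cube n → Z} {ε : ℝ} (hε : 0 < ε)
    (hε' : ε ≤ 1 / 4) (hk : IsTameMapWith ε fun s : cubeBoundary n => k s.1) {s y : cube n}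
    (hs : s ∈ cubeBoundary n) (hsy : ∀ i, s.1 i = 0 ∨ s.1 i = 1 → y.1 i = s.1 i)
    (hr : ∀ i, round ε (y.1 i) = round ε (s.1 i)) (r : unitInterval) :
    k (segment s y r) = k s := by
  have hmem : segment s y r ∈ cubeBoundary n := by
    obtain ⟨i, hi⟩ := hs
    refine ⟨i, ?_⟩
    have : (segment s y r).1 i = s.1 i := by simp [segment, hsy i hi]
    rwa [this]
  exact hk.eq_of_round_eq hε hε' (s := ⟨_, hmem⟩) (s' := ⟨s, hs⟩) fun i =>
    round_segment hε' (hr i) (s.2 i).1 (y.2 i).1 (s.2 i).2 (y.2 i).2 r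

theorem round_clampCube {ε : ℝ} (hε : 0 < ε) (hε' : ε ≤ 1 / 4) {n : ℕ} (x : cube n) (i : Fin n) :
    round ε ((clampCube hε hε' x.1).1 i) = round ε (x.1 i) :=
  round_clamp hε hε' (x.2 i).1 (x.2 i).2

theorem clampCube_apply_eq {ε : ℝ} (hε : 0 < ε) (hε' : ε ≤ 1 / 4) {n : ℕ} {x : cube n} {i : Fin n}
    (h : x.1 i = 0 ∨ x.1 i = 1) : (clampCube hε hε' x.1).1 i = x.1 i := by
  show clamp ε (x.1 i) = x.1 i
  rcases h with h | h <;> rw [h]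
  exacts [clamp_eq_zero hε hε' (by linarith), clamp_eq_one hε (by linarith)]

/-! ### Homotopy extension for the cube -/

/-- Homotopy extension for the pair of the cube and its boundary, for homotopies which are tame on
the boundary and stationary near time `0`. -/
theorem exists_homotopy_extension {n : ℕ} {Z : Type*} [DiffeologicalSpace Z] {ε : ℝ} (hε : 0 < ε)
    (hε' : ε ≤ 1 / 4) {u : cube n → Z} (hu : DSmooth u) {h : cubeBoundary n × unitInterval → Z}
    (hh : DSmooth h) (htame : ∀ t, IsTameMapWith ε fun s => h (s, t))
    (h0 : ∀ s (t : unitInterval), (t : ℝ) ≤ 1 / 4 → h (s, t) = u s.1) :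
    ∃ G : cube n × unitInterval → Z, DSmooth G ∧ (∀ x, G (x, 0) = u x) ∧
      ∀ (s : cubeBoundary n) t, G (s.1, t) = h (s, t) := by
  classical
  let T : cube n → cube n := fun x => clampCube hε hε' x.1
  have hT : DSmooth T := (dSmooth_clampCube hε hε').comp dSmooth_val
  -- Damped time: it is the true time on the boundary and 0 where the bump is 1. Positive damped
  -- time thus puts `T x` in the boundary, where `h` is defined.
  let θ : cube n × unitInterval → unitInterval := fun y =>
    y.2 * ⟨1 - bump ε y.1, sub_nonneg.2 (bump_le_one ε y.1), by linarith [bump_nonneg ε y.1]⟩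
  have hθ' : DSmooth fun y => (θ y : ℝ) :=
    (dSmooth_val.comp dSmooth_snd).mul (dSmooth_const.sub ((dSmooth_bump ε).comp dSmooth_fst))
  have hθ : DSmooth θ := hθ'.subtype_mk fun y => (θ y).2
  have hθ_le : ∀ y, (θ y : ℝ) ≤ y.2 := fun y =>
    mul_le_of_le_one_right y.2.2.1 (by linarith [bump_nonneg ε y.1])
  have hmem : ∀ y, 0 < (θ y : ℝ) → T y.1 ∈ cubeBoundary n := fun y hy => by
    refine clampCube_mem_boundary_of_bump hε hε' fun hb => hy.ne' ?_
    show (y.2 : ℝ) * (1 - bump ε y.1) = 0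
    rw [hb, sub_self, mul_zero]
  -- The slide from x to `T x` is finished at time 1/8. Since `θ ≤ t`, for 1/8 < θ < 1/4 both
  -- formulas give `u (T x)`, `h` being still stationary.
  let G₁ : cube n × unitInterval → Z := fun y => u (segment y.1 (T y.1) (timeStep 8 0 y.2))
  have hG₁ : DSmooth G₁ :=
    hu.comp (dSmooth_segment dSmooth_fst (hT.comp dSmooth_fst)
      ((dSmooth_timeStep 8 0).comp dSmooth_snd))
  let G : cube n × unitInterval → Z := fun y =>
    if hy : (θ y : ℝ) < 1 / 4 then G₁ y else
      h (⟨T y.1, hmem y (by linarith)⟩, θ y)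
  let G₂ : {y : cube n × unitInterval // 1 / 8 < (θ y : ℝ)} → Z := fun y =>
    h (⟨T y.1.1, hmem y.1 ((by norm_num : (0 : ℝ) < 1 / 8).trans y.2)⟩, θ y.1)
  have hG₂ : DSmooth G₂ := hh.comp
    ((((hT.comp dSmooth_fst).comp dSmooth_val).subtype_mk _).prodMk (hθ.comp dSmooth_val))
  refine ⟨G, dSmooth_of_cover hθ' (show (1 / 8 : ℝ) < 1 / 4 by norm_num)
    (hG₁.comp dSmooth_val) hG₂ (fun y => dif_pos y.2) fun y => ?_, fun x => ?_, fun s t => ?_⟩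
  · by_cases hy : (θ y.1 : ℝ) < 1 / 4
    · have h8 : timeStep 8 0 y.1.2 = 1 := timeStep_eq_one (by linarith [y.2, hθ_le y.1])
      simp only [G, G₁, G₂, dif_pos hy, h8, segment_one]
      rw [h0 _ _ hy.le]
    · simp only [G, G₂, dif_neg hy]
  · have : (θ (x, 0) : ℝ) < 1 / 4 := (hθ_le _).trans_lt (by norm_num)
    simp only [G, G₁, dif_pos this]
    rw [timeStep_eq_zero (by simp), segment_zero]
  · have hθs : θ (s.1, t) = t := Subtype.ext (by
      show (t : ℝ) * (1 - bump ε s.1) = t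
      rw [bump_boundary ε s.2, sub_zero, mul_one])
    by_cases ht : (θ (s.1, t) : ℝ) < 1 / 4
    · have hu' : IsTameMapWith ε fun s : cubeBoundary n => u s.1 := by
        have := htame 0
        simp only [fun s => h0 s 0 (by norm_num)] at this
        exact this
      simp only [G, G₁, dif_pos ht]
      rw [h0 s t (hθs ▸ ht).le]
      exact eq_segment_of_tame hε hε' hu' s.2 (fun i => clampCube_apply_eq hε hε')
        (round_clampCube hε hε' s.1) _
    · simp only [G, dif_neg ht, hθs]
      exact (htame t).eq_of_round_eq hε hε' (round_clampCube hε hε' s.1)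

/-! ### Pushing the horn to a point -/

section Push

variable {n : ℕ}

/-- The first step of the push: expansion from the centre of the bottom face. -/
noncomputable def expand (x : EuclideanSpace ℝ (Fin n)) (s : ℝ) (j : Fin n) : ℝ :=
  1 / 2 + (1 + 2 * s) * (x j - 1 / 2)

/-- A function of the coordinates other than `ℓ` which is `1` if none of these lies outside the unit
interval, and `0` if one lies at distance at least `1` from the interval. -/
noncomputable def sideBump (ℓ : Fin n) (y : Fin n → ℝ) : ℝ :=
  ∏ j ∈ Finset.univ.erase ℓ,
    ((1 - Real.smoothTransition (-(y j))) * (1 - Real.smoothTransition (y j - 1)))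

/-- The height of a point after points beside the cube have been lifted above it. -/
noncomputable def lift (ℓ : Fin n) (x : EuclideanSpace ℝ (Fin n)) (s : ℝ) : ℝ :=
  (1 + 2 * s) * x ℓ + 3 * s * (1 - sideBump ℓ (expand x s))

/-- The amount by which a point above the cube is moved towards the point over the centre. -/
noncomputable def pull (ℓ : Fin n) (x : EuclideanSpace ℝ (Fin n)) (s : ℝ) : ℝ :=
  s * Real.smoothTransition ((lift ℓ x s - 1) / 2)

/-- A homotopy of self-maps of Euclidean space which preserves the complement of the open unit cube
and moves all faces but the bottom one to a single point. -/
noncomputable def push (ℓ : Fin n) (x : EuclideanSpace ℝ (Fin n)) (s : ℝ) :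
    EuclideanSpace ℝ (Fin n) :=
  WithLp.toLp 2 fun j => if j = ℓ then lift ℓ x s + pull ℓ x s * (3 - lift ℓ x s) else
    expand x s j + pull ℓ x s * (1 / 2 - expand x s j)

section Smooth

variable {X : Type*} [DiffeologicalSpace X] {e : X → EuclideanSpace ℝ (Fin n)} {r : X → ℝ}

theorem dSmooth_push (ℓ : Fin n) (he : DSmooth e) (hr : DSmooth r) :
    DSmooth fun x => push ℓ (e x) (r x) := by
  have hS : ContDiff ℝ ∞ Real.smoothTransition := Real.smoothTransition.contDiff
  have hc : ∀ j, DSmooth fun x => e x j := fun j => (dSmooth_coord j).comp he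
  have h1 : DSmooth fun x => 1 + 2 * r x := dSmooth_const.add (dSmooth_const.mul hr)
  have hexp : ∀ j, DSmooth fun x => expand (e x) (r x) j := fun j =>
    dSmooth_const.add (h1.mul ((hc j).sub dSmooth_const))
  have hneg : ContDiff ℝ ∞ fun y : ℝ => 1 - Real.smoothTransition (-y) :=
    contDiff_const.sub (hS.comp contDiff_neg)
  have hone : ContDiff ℝ ∞ fun y : ℝ => 1 - Real.smoothTransition (y - 1) :=
    contDiff_const.sub (hS.comp (contDiff_id.sub contDiff_const))
  have hhalf : ContDiff ℝ ∞ fun y : ℝ => Real.smoothTransition ((y - 1) / 2) :=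
    hS.comp ((contDiff_id.sub contDiff_const).div_const 2)
  have hside : DSmooth fun x => sideBump ℓ (expand (e x) (r x)) :=
    DSmooth.finset_prod fun j _ => (hneg.dSmooth.comp (hexp j)).mul (hone.dSmooth.comp (hexp j))
  have hlift : DSmooth fun x => lift ℓ (e x) (r x) :=
    (h1.mul (hc ℓ)).add ((dSmooth_const.mul hr).mul (dSmooth_const.sub hside))
  have hpull : DSmooth fun x => pull ℓ (e x) (r x) :=
    hr.mul (hhalf.dSmooth.comp hlift)
  refine dSmooth_euclidean fun j => ?_
  by_cases hj : j = ℓ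
  · simpa [push, hj] using hlift.add (hpull.mul (dSmooth_const.sub hlift))
  · simpa [push, hj] using (hexp j).add (hpull.mul (dSmooth_const.sub (hexp j)))

end Smooth

theorem push_zero (ℓ : Fin n) (x : EuclideanSpace ℝ (Fin n)) : push ℓ x 0 = x := by
  refine PiLp.ext fun j => ?_
  by_cases hj : j = ℓ <;> simp [push, hj, lift, pull, expand]

theorem sideBump_le_one (ℓ : Fin n) (y : Fin n → ℝ) : sideBump ℓ y ≤ 1 := by
  have h0 := Real.smoothTransition.nonneg
  have h1 := Real.smoothTransition.le_one
  exact Finset.prod_le_one (fun j _ => mul_nonneg (sub_nonneg.2 (h1 _)) (sub_nonneg.2 (h1 _)))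
    fun j _ => mul_le_one₀ (by linarith [h0 (-(y j))]) (sub_nonneg.2 (h1 _))
      (by linarith [h0 (y j - 1)])

/-- If the lifted height is at least 1, pulling towards height 3 keeps it so. Otherwise there is no
pull. If moreover all side coordinates lie strictly inside, the point started on no side face
(expansion moves these outwards) nor on the top; on the bottom the side bump is 1, so the height
stays 0. -/
theorem push_mem_compl (ℓ : Fin n) (x : cube n) (hx : x ∈ cubeBoundary n) {s : ℝ} (hs : 0 ≤ s)
    (hs' : s ≤ 1) : ∃ j, push ℓ x.1 s j ≤ 0 ∨ 1 ≤ push ℓ x.1 s j := by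
  have hlift0 : (1 + 2 * s) * x.1 ℓ ≤ lift ℓ x.1 s := by
    have := mul_nonneg hs (sub_nonneg.2 (sideBump_le_one ℓ (expand x.1 s)))
    rw [lift]
    linarith
  rcases le_or_gt 1 (lift ℓ x.1 s) with hl | hl
  · refine ⟨ℓ, Or.inr ?_⟩
    have hp0 : 0 ≤ pull ℓ x.1 s := mul_nonneg hs (Real.smoothTransition.nonneg _)
    have hp1 : pull ℓ x.1 s ≤ 1 := mul_le_one₀ hs' (Real.smoothTransition.nonneg _)
      (Real.smoothTransition.le_one _)
    simp only [push, if_true]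
    nlinarith
  have hp : pull ℓ x.1 s = 0 := by
    rw [pull, Real.smoothTransition.zero_of_nonpos (by linarith), mul_zero]
  by_cases hy : ∃ j, j ≠ ℓ ∧ (expand x.1 s j ≤ 0 ∨ 1 ≤ expand x.1 s j)
  · obtain ⟨j, hj, h⟩ := hy
    exact ⟨j, by simpa [push, hj, hp] using h⟩
  push Not at hy
  obtain ⟨i, hi⟩ := hx
  have hiℓ : i = ℓ := by
    by_contra hne
    have := hy i hne
    unfold expand at this
    rcases hi with hi | hi <;> rw [hi] at this <;> linarith
  subst hiℓ
  rcases hi with hi | hi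
  · refine ⟨i, Or.inl ?_⟩
    have hside : sideBump i (expand x.1 s) = 1 := Finset.prod_eq_one fun j hj => by
      have := hy j (Finset.ne_of_mem_erase hj)
      rw [Real.smoothTransition.zero_of_nonpos (by linarith),
        Real.smoothTransition.zero_of_nonpos (by linarith)]
      norm_num
    simp [push, hp, lift, hi, hside]
  · rw [hi] at hlift0
    linarith

/-- At time 1 the expansion factor is 3: side faces go to coordinates -1 and 2, where the side bump
vanishes and the lift adds 3, while the top face goes to height at least 3. There the pull is
complete. -/
theorem push_one_horn {ℓ : Fin n} (hℓ : ℓ.1 + 1 = n) {x : cube n} (hx : x ∈ cubeHorn n) :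
    push ℓ x.1 1 = WithLp.toLp 2 fun j => if j = ℓ then 3 else 1 / 2 := by
  have hl : 3 ≤ lift ℓ x.1 1 := by
    rcases hx with ⟨i, hi, hxi⟩ | ⟨i, hi, hxi⟩
    · have hside : sideBump ℓ (expand x.1 1) = 0 := by
        have hne : i ≠ ℓ := by
          rintro rfl
          omega
        refine Finset.prod_eq_zero (Finset.mem_erase.2 ⟨hne, Finset.mem_univ i⟩) ?_
        rcases hxi with h | h <;> norm_num [expand, h]
      rw [lift, hside]
      linarith [(x.2 ℓ).1]
    · have hiℓ : i = ℓ := Fin.ext (by omega)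
      rw [lift, ← hiℓ, hxi]
      linarith [sideBump_le_one i (expand x.1 1)]
  have hp : pull ℓ x.1 1 = 1 := by
    rw [pull, Real.smoothTransition.one_of_one_le (by linarith), mul_one]
  refine PiLp.ext fun j => ?_
  by_cases hj : j = ℓ <;> simp [push, hj, hp]

end Push

/-! ### Compression into the subspace -/

/-- If `π_n(Z, C)` vanishes, a smooth map of pairs `(I^n, ∂I^n) → (Z, C)` is, after a clamp,
homotopic through maps of pairs to a constant map. -/
theorem exists_homotopy_const {n : ℕ} (hn : 1 ≤ n) {Z : Type*} [DiffeologicalSpace Z] {C : Set Z}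
    (hπ : ∀ (c : C) (a : RelPi n C c), a = RelPi.zero n C c) {ε : ℝ} (hε : 0 < ε)
    (hε' : ε ≤ 1 / 4) {k : cube n → Z} (hk : DSmooth k) (hkC : Set.MapsTo k (cubeBoundary n) C) :
    ∃ c ∈ C, ∃ P : cube n × unitInterval → Z,
      IsHomotopy P (fun x => k (clampCube hε hε' x.1)) (fun _ => c) ∧
      ∀ s ∈ cubeBoundary n, ∀ t, P (s, t) ∈ C := by
  let ℓ : Fin n := ⟨n - 1, by omega⟩
  have hℓ : ℓ.1 + 1 = n := by
    show n - 1 + 1 = n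
    omega
  -- Pushing and then clamping keeps the boundary in the boundary, hence in `C`, and at time 1 sends
  -- the horn to the single point `p`. Thus `Q (·, 1)` represents an element of π_n based at `k p`.
  let Q : cube n × unitInterval → Z := fun y => k (clampCube hε hε' (push ℓ y.1.1 y.2))
  have hQ : DSmooth Q := (hk.comp (dSmooth_clampCube hε hε')).comp
    (dSmooth_push ℓ (dSmooth_val.comp dSmooth_fst) (dSmooth_val.comp dSmooth_snd))
  have hQC : ∀ s ∈ cubeBoundary n, ∀ t, Q (s, t) ∈ C := fun s hs t => by
    obtain ⟨j, hj⟩ := push_mem_compl ℓ s hs t.2.1 t.2.2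
    exact hkC (clampCube_mem_boundary hε hε' (i := j)
      (hj.imp (fun h => h.trans (by linarith)) fun h => le_trans (by linarith) h))
  let p : cube n := clampCube hε hε' (WithLp.toLp 2 fun j => if j = ℓ then 3 else 1 / 2)
  have hp : k p ∈ C := hkC (clampCube_mem_boundary hε hε' (i := ℓ) (Or.inr (by
    simp only [if_true]
    linarith)))
  have hQp : ∀ x ∈ cubeHorn n, Q (x, 1) = k p := fun x hx =>
    congrArg (fun y => k (clampCube hε hε' y)) (push_one_horn hℓ hx)
  have hQ1 : DSmooth fun x => Q (x, 1) := hQ.comp (dSmooth_id.prodMk dSmooth_const)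
  obtain ⟨L, hL, hL₁, -⟩ := TripleClasses.exact (hπ ⟨k p, hp⟩ (Quot.mk _
    ⟨fun x => Q (x, 1), hQ1, fun s hs => hQC s hs 1, fun x hx => hQp x hx⟩))
  have hQh : IsHomotopy Q (fun x => k (clampCube hε hε' x.1)) (fun x => Q (x, 1)) :=
    ⟨hQ, fun x => congrArg (fun y => k (clampCube hε hε' y)) (push_zero ℓ x.1), fun _ => rfl⟩
  exact ⟨k p, hp, concat Q L, hQh.concat hL, fun s hs => concat_mem (hQC s hs) (hL₁ s hs)⟩

/-- If `π_n(Z, C)` vanishes, a smooth map of pairs `(I^n, ∂I^n) → (Z, C)` which is tame on the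
boundary can be deformed into `C` relative to the boundary. -/
theorem exists_compression {n : ℕ} (hn : 1 ≤ n) {Z : Type*} [DiffeologicalSpace Z] {C : Set Z}
    (hπ : ∀ (c : C) (a : RelPi n C c), a = RelPi.zero n C c) {ε : ℝ} (hε : 0 < ε)
    (hε' : ε ≤ 1 / 4) {k : cube n → Z} (hk : DSmooth k) (hkC : Set.MapsTo k (cubeBoundary n) C)
    (htame : IsTameMapWith ε fun s : cubeBoundary n => k s.1) :
    ∃ (g : cube n → Z) (G : cube n × unitInterval → Z), IsHomotopy G k g ∧ (∀ x, g x ∈ C) ∧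
      ∀ s ∈ cubeBoundary n, ∀ t, G (s, t) = k s := by
  obtain ⟨c, hc, P, hP, hPC⟩ := exists_homotopy_const hn hπ hε hε' hk hkC
  let T : cube n → cube n := fun x => clampCube hε hε' x.1
  have hT : DSmooth T := (dSmooth_clampCube hε hε').comp dSmooth_val
  have hTT : ∀ s ∈ cubeBoundary n, ∀ r, k (segment s (T (T s)) r) = k s := fun s hs r =>
    eq_segment_of_tame hε hε' htame hs
      (fun i hi => by
        have h := clampCube_apply_eq hε hε' hi
        exact (clampCube_apply_eq hε hε' (x := T s) (h.symm ▸ hi)).trans h)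
      (fun i => (round_clampCube hε hε' (T s) i).trans (round_clampCube hε hε' s i)) r
  -- Two clamps are needed: `P` starts at k ∘ T, and it will itself be evaluated at `T x`.
  have h₁ : IsHomotopy (fun y : cube n × unitInterval => k (segment y.1 (T (T y.1)) y.2)) k
      (fun x => k (T (T x))) :=
    ⟨hk.comp (dSmooth_segment dSmooth_fst (hT.comp (hT.comp dSmooth_fst)) dSmooth_snd),
      fun x => by rw [segment_zero], fun x => by rw [segment_one]⟩
  -- Run `P (T x, ·)` only up to time bump x. Where the bump is 1 it ends at `c`; elsewhere `T x` is
  -- a boundary point, where `P` stays in `C`; on the boundary it does not move.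
  let m : cube n → unitInterval := fun x => ⟨bump ε x, bump_nonneg ε x, bump_le_one ε x⟩
  have h₂ : IsHomotopy (fun y : cube n × unitInterval => P (T y.1, y.2 * m y.1))
      (fun x => k (T (T x))) (fun x => P (T x, m x)) :=
    ⟨hP.smooth.comp ((hT.comp dSmooth_fst).prodMk (((dSmooth_val.comp dSmooth_snd).mul
      ((dSmooth_bump ε).comp dSmooth_fst)).subtype_mk fun y => (y.2 * m y.1).2)),
      fun x => by rw [zero_mul, hP.map_zero], fun x => by rw [one_mul]⟩
  refine ⟨_, _, h₁.concat h₂, fun x => ?_, fun s hs => ?_⟩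
  · by_cases hx : bump ε x = 1
    · have : m x = 1 := Subtype.ext hx
      rw [this, hP.map_one]
      exact hc
    · exact hPC _ (clampCube_mem_boundary_of_bump hε hε' hx) _
  · refine concat_mem (B := {k s}) (fun t => hTT s hs t) fun t => ?_
    have hm : m s = 0 := Subtype.ext (bump_boundary ε hs)
    have := hTT s hs 1
    rw [segment_one] at this
    show P (T s, t * m s) = k s
    rw [hm, mul_zero, hP.map_zero]
    exact this

/-! ### Deformation of cells and of skeleta -/

/-- Homotopy extension followed by compression of its end. The second move is constant on the
boundary, so concatenation merely reparametrizes `h`, by a time change which is the same for all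
cells. -/
theorem exists_cell_deformation {n N : ℕ} (hn : n ≤ N) {Z : Type*} [DiffeologicalSpace Z]
    {C : Set Z} (hconn : IsConnectedPair N C) {u : cube n → Z} (hu : DSmooth u)
    {h : cubeBoundary n × unitInterval → Z} (hh : DSmooth h) {ε : ℝ} (hε : 0 < ε)
    (htame : ∀ t, IsTameMapWith ε fun s => h (s, t))
    (h0 : ∀ s (t : unitInterval), (t : ℝ) ≤ 1 / 4 → h (s, t) = u s.1) (h1 : ∀ s, h (s, 1) ∈ C) :
    ∃ G : cube n × unitInterval → Z, DSmooth G ∧ (∀ x, G (x, 0) = u x) ∧ (∀ x, G (x, 1) ∈ C) ∧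
      ∀ (s : cubeBoundary n) t, G (s.1, t) = h (s, timeStep 3 0 t) := by
  -- A 0-cell is a point with empty boundary; surjectivity on π₀ supplies a path from `C`, to be
  -- reversed.
  rcases Nat.eq_zero_or_pos n with rfl | hpos
  · let x₀ : cube 0 := ⟨0, fun i => i.elim0⟩
    have hx₀ : ∀ x, x = x₀ := fun x => Subtype.ext (Subsingleton.elim _ _)
    obtain ⟨⟨c⟩, hc⟩ := hconn.1 (Quot.mk _ (u x₀))
    obtain ⟨F, hF⟩ := Pi0.exact (cube 0) hc
    refine ⟨_, hF.symm.smooth, fun x => ?_, fun x => ?_, fun s => s.2.choose.elim0⟩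
    · rw [hF.symm.map_zero, hx₀ x]
    · rw [hF.symm.map_one]
      exact c.2
  have hδ : 0 < min ε (1 / 4) := lt_min hε (by norm_num)
  have htame' := fun t => (htame t).mono (min_le_left ε (1 / 4))
  obtain ⟨F, hF, hF0, hFh⟩ :=
    exists_homotopy_extension hδ (min_le_right _ _) hu hh htame' h0
  obtain ⟨g, G, hG, hg, hGs⟩ := exists_compression hpos (hconn.2 n hpos hn) hδ (min_le_right _ _)
    (k := fun x => F (x, 1)) (C := C) (hF.comp (dSmooth_id.prodMk dSmooth_const))
    (fun s hs => by
      show F ((⟨s, hs⟩ : cubeBoundary n).1, 1) ∈ C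
      rw [hFh]
      exact h1 _)
    (by
      simp only [hFh]
      exact htame' 1)
  have hFG : IsHomotopy (concat F G) u g :=
    IsHomotopy.concat ⟨hF, hF0, fun _ => rfl⟩ hG
  refine ⟨_, hFG.smooth, hFG.map_zero, fun x => ?_, fun s t => ?_⟩
  · rw [hFG.map_one]
    exact hg x
  · simp only [concat]
    split_ifs with ht
    · exact hFh s _
    · rw [hGs _ s.2, hFh, timeStep_eq_one (by linarith)]

/-- A smooth deformation of `f`, restricted to the subset `Y`, into `C` relative to `A`. -/
structure IsDeformation {X Z : Type*} [DiffeologicalSpace X] [DiffeologicalSpace Z] (A Y : Set X)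
    (C : Set Z) (f : X → Z) (F : Y × unitInterval → Z) : Prop where
  smooth : DSmooth F
  map_zero : ∀ y, F (y, 0) = f y
  map_one_mem : ∀ y, F (y, 1) ∈ C
  rel : ∀ y, y.1 ∈ A → ∀ t, F (y, t) = f y

/-- Make a deformation stationary near both ends. -/
theorem IsDeformation.tame {X Z : Type*} [DiffeologicalSpace X] [DiffeologicalSpace Z]
    {A Y : Set X} {C : Set Z} {f : X → Z} {F : Y × unitInterval → Z}
    (hF : IsDeformation A Y C f F) :
    IsDeformation A Y C f (fun y => F (y.1, timeStep 2 (-1 / 2) y.2)) where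
  smooth := dSmooth_reparam hF.smooth _ _
  map_zero y := by rw [timeStep_eq_zero (by norm_num), hF.map_zero]
  map_one_mem y := by
    rw [timeStep_eq_one (by norm_num)]
    exact hF.map_one_mem y
  rel y hy t := hF.rel y hy _

/-- The new deformation restricts on the old skeleton to a reparametrization of `F`, not to `F`
itself; this is harmless, as only its ends and its constancy on `A` matter. -/
theorem exists_deformation_succ {X : Type u} [DiffeologicalSpace X] {A : Set X} {Z : Type w}
    [DiffeologicalSpace Z] {C : Set Z} {N n : ℕ} (hn : n ≤ N) (K : RelCWComplex.{u, v} X A)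
    (hgathered : K.IsGathered) (hconn : IsConnectedPair N C) {f : X → Z} (hf : DSmooth f)
    (hA : A ⊆ K.skel n) {F : K.skel n × unitInterval → Z}
    (hF : IsDeformation A (K.skel n) C f F) :
    ∃ F', IsDeformation A (K.skel (n + 1)) C f F' := by
  have hP := K.isPushout n
  -- Stationary for t ≤ 1/4, as homotopy extension requires.
  let F₀ : K.skel n × unitInterval → Z := fun y => F (y.1, timeStep 2 (-1 / 2) y.2)
  have hF₀ : IsDeformation A (K.skel n) C f F₀ := hF.tame
  have hF₀' : ∀ y (t : unitInterval), (t : ℝ) ≤ 1 / 4 → F₀ (y, t) = f y := fun y t ht => by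
    show F (y, timeStep _ _ t) = _
    rw [timeStep_eq_zero (by linarith), hF.map_zero]
  have hattach : ∀ c, DSmooth (K.attach n c) := fun c =>
    hP.smooth_left.comp (dSmooth_sigma_mk c)
  have hchar : ∀ c, DSmooth (K.char n c) := fun c => by
    have h : DSmooth fun s : (Σ _ : K.Cell n, cube n) => K.char n s.1 s.2 :=
      (coinduced_le_iff _ _).1 (le_sup_right.trans hP.final.ge)
    exact h.comp (dSmooth_sigma_mk c)
  have hcomm : ∀ c s, K.char n c s.1 = Set.inclusion (K.skel_subset_succ n) (K.attach n c s) :=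
    fun c s => ((hP.eq_iff (Sum.inl (K.attach n c s)) (Sum.inr ⟨c, s.1⟩)).2
      (Relation.EqvGen.rel _ _ ⟨⟨c, s⟩, rfl, rfl⟩)).symm
  have hcell : ∀ c : K.Cell n, ∃ G : cube n × unitInterval → Z, DSmooth G ∧
      (∀ x, G (x, 0) = f (K.char n c x)) ∧ (∀ x, G (x, 1) ∈ C) ∧
      ∀ (s : cubeBoundary n) t, G (s.1, t) = F₀ (K.attach n c s, timeStep 3 0 t) := fun c => by
    obtain ⟨ε, hε, -, htame⟩ := hgathered n c
    exact exists_cell_deformation hn hconn (u := fun x => f (K.char n c x))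
      (h := fun y => F₀ (K.attach n c y.1, y.2)) (hf.comp (dSmooth_val.comp (hchar c)))
      (hF₀.smooth.comp (((hattach c).comp dSmooth_fst).prodMk dSmooth_snd)) hε
      (fun t => htame.comp fun a => F₀ (a, t))
      (fun s t ht => by
        rw [hF₀' _ _ ht, hcomm])
      fun s => hF₀.map_one_mem _
  choose G hG hG0 hG1 hGs using hcell
  -- Descent takes place on underlying sets, with values in functions of time; smoothness of the
  -- uncurried map is checked separately on both legs of the pushout.
  obtain ⟨φ, hφ₁, hφ₂⟩ := hP.exists_desc (W := unitInterval → Z)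
    (fun y t => F₀ (y, timeStep 3 0 t)) (fun x t => G x.1 (x.2, t))
    fun s => funext fun t => (hGs s.1 s.2 t).symm
  refine ⟨fun y => φ y.1 y.2, hP.dSmooth_prod ?_ ?_, fun y => ?_, fun y => ?_, fun y hy t => ?_⟩
  · simp only [hφ₁]
    exact dSmooth_reparam hF₀.smooth 3 0
  · simp only [hφ₂]
    exact dSmooth_sigma_prod hG
  · obtain ⟨y | y, rfl⟩ := hP.surjective y
    · simp only [Sum.elim_inl, hφ₁]
      rw [timeStep_eq_zero (by simp), hF₀.map_zero]
    · simp only [Sum.elim_inr, hφ₂, hG0]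
  · obtain ⟨y | y, rfl⟩ := hP.surjective y
    · simp only [Sum.elim_inl, hφ₁]
      rw [timeStep_eq_one (by norm_num)]
      exact hF₀.map_one_mem y
    · simp only [Sum.elim_inr, hφ₂]
      exact hG1 _ _
  · have e : y = Set.inclusion (K.skel_subset_succ n) ⟨y.1, hA hy⟩ := rfl
    rw [e]
    simp only [hφ₁]
    exact hF₀.rel _ hy _

theorem RelCWComplex.subset_skel {X : Type u} [DiffeologicalSpace X] {A : Set X}
    (K : RelCWComplex.{u, v} X A) (n : ℕ) : A ⊆ K.skel n := by
  induction n with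
  | zero => exact K.skel_zero.ge
  | succ n ih => exact ih.trans (K.skel_subset_succ n)

/-- With the shifted indexing, passing from `K.skel n` to `K.skel (n + 1)` attaches n-cells, so
reaching `K.skel (N + 1)` uses connectivity only up to degree N. -/
theorem exists_deformation {X : Type u} [DiffeologicalSpace X] {A : Set X} {Z : Type w}
    [DiffeologicalSpace Z] {C : Set Z} {N : ℕ} (K : RelCWComplex.{u, v} X A)
    (hgathered : K.IsGathered) (hconn : IsConnectedPair N C) {f : X → Z} (hf : DSmooth f)
    (hfAC : Set.MapsTo f A C) {n : ℕ} (hn : n ≤ N + 1) :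
    ∃ F, IsDeformation A (K.skel n) C f F := by
  induction n with
  | zero =>
    exact ⟨fun y => f y.1, (hf.comp dSmooth_val).comp dSmooth_fst, fun _ => rfl,
      fun y => hfAC (K.skel_zero.le y.2), fun _ _ _ => rfl⟩
  | succ n ih =>
    obtain ⟨F, hF⟩ := ih (by omega)
    exact exists_deformation_succ (by omega) K hgathered hconn hf (K.subset_skel n) hF

end SmoothCW

theorem mainTheorem8 {X : Type u} [DiffeologicalSpace X] {A : Set X}
    {Z : Type w} [DiffeologicalSpace Z] {C : Set Z} (N : ℕ)
    (K : SmoothCW.RelCWComplex.{u, v} X A) (hgathered : K.IsGathered) (hdim : K.HasDim N)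
    (hconn : SmoothCW.IsConnectedPair N C)
    (f : X → Z) (hf : Diffeology.DSmooth f) (hfAC : Set.MapsTo f A C) :
    ∃ g : X → Z, Diffeology.DSmooth g ∧ Set.MapsTo g A C ∧ (∀ x, g x ∈ C) ∧
      ∃ F : X × unitInterval → Z, SmoothCW.IsHomotopy F f g ∧ SmoothCW.IsTameHomotopy F ∧
        (∀ a ∈ A, ∀ t, F (a, t) ∈ C) ∧
        (∀ a ∈ A, ∀ t, F (a, t) = f a ∧ F (a, t) = g a) := by
  obtain ⟨F, hF⟩ := SmoothCW.exists_deformation K hgathered hconn hf hfAC le_rfl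
  have hmem : ∀ x, x ∈ K.skel (N + 1) := fun x => hdim.ge (Set.mem_univ x)
  -- The argument 2t - 1/2 is at most 0 for t ≤ 1/4 and at least 1 for t ≥ 3/4, whence tameness with
  -- constant 1/4.
  let H : X × unitInterval → Z := fun y =>
    F (⟨y.1, hmem y.1⟩, SmoothCW.timeStep 2 (-1 / 2) y.2)
  have hH : Diffeology.DSmooth H := hF.tame.smooth.comp
    ((SmoothCW.dSmooth_fst.subtype_mk fun y => hmem y.1).prodMk SmoothCW.dSmooth_snd)
  have hrel : ∀ a ∈ A, ∀ t, H (a, t) = f a := fun a ha t => hF.tame.rel ⟨a, hmem a⟩ ha t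
  have hC : ∀ x, H (x, 1) ∈ C := fun x => hF.tame.map_one_mem _
  refine ⟨fun x => H (x, 1), hH.comp (Diffeology.dSmooth_id.prodMk Diffeology.dSmooth_const),
    fun a _ => hC a, hC, H, ⟨hH, fun x => hF.tame.map_zero _, fun _ => rfl⟩,
    ⟨1 / 4, by norm_num, by norm_num, ?_⟩, fun a ha t => (hrel a ha t).symm ▸ hfAC ha,
    fun a ha t => ⟨hrel a ha t, (hrel a ha t).trans (hrel a ha 1).symm⟩⟩
  rintro x t α (rfl | rfl) ht
  · have ht' := (abs_le.1 ht).2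
    simp only [Set.Icc.coe_zero] at ht'
    simp only [H]
    rw [SmoothCW.timeStep_eq_zero (by linarith), SmoothCW.timeStep_eq_zero (by norm_num)]
  · have ht' := (abs_le.1 ht).1
    simp only [Set.Icc.coe_one] at ht'
    simp only [H]
    rw [SmoothCW.timeStep_eq_one (by linarith), SmoothCW.timeStep_eq_one (by norm_num)]
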